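/- Let $R$ be an associative ring with identity; unless otherwise stated, modules are unital left $R$-modules. A submodule $A$ of a module $B$ is called coneat if the sequence $0\to U\otimes_R A\to U\otimes_R B\to U\otimes_R (B/A)\to 0$ is exact for every simple right $R$-module $U$; a left ideal of $R$ is coneat if it is coneat as a submodule of the left module $R$. A module $M$ is called - $R$-coneat injective if, for every coneat left ideal $C$ of $R$, every homomorphism $C\to M$ extends to a homomorphism $R\to M$; - self coneat injective if, for every coneat left ideal $C$ of $R$, every homomorphism $f: C\to M$ such that $\ker f\supseteq \operatorname{ann}(m)=\{r\in R: rm=0\}$ for some $m\in M$ extends to a homomorphism $R\to M$; - quasi injective if, for every submodule $A$ of $M$, every homomorphism $A\to M$ extends to an endomorphism of $M$. The ring $R$ is a right SF-ring if every simple right $R$-module is flat. **Theorem.** The following five statements are equivalent for a ring $R$: 1. $R$ is a right SF-ring. 2. Every left ideal of $R$ is coneat. 3. Every $R$-coneat injective module is injective. 4. Every $R$-coneat injective module is quasi injective. 5. Every self coneat injective module is quasi injective. If $R$ is commutative, then these are also equivalent to: 6. $R$ is von Neumann regular, i.e. for every $a\in R$ there is $x\in R$ with $a=axa$. -/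

import Mathlib

open scoped TensorProduct

universe u v w

namespace ConeatInj

section Tensor

/-- The subgroup of `U ⊗[ℤ] A` generated by the elements `(u r) ⊗ a - u ⊗ (r a)`, where `U` is a
right `R`-module (a module over `Rᵐᵒᵖ`) and `A` is a left `R`-module. -/
def balancedRel (R : Type u) [Ring R] (U : Type v) [AddCommGroup U] [Module Rᵐᵒᵖ U]
    (A : Type w) [AddCommGroup A] [Module R A] : Submodule ℤ (U ⊗[ℤ] A) :=
  Submodule.span ℤ
    {z | ∃ (u : U) (r : R) (a : A), z = (MulOpposite.op r • u) ⊗ₜ[ℤ] a - u ⊗ₜ[ℤ] (r • a)}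

/-- The abelian group `U ⊗_R A` for a right `R`-module `U` and a left `R`-module `A`. -/
abbrev RTensor (R : Type u) [Ring R] (U : Type v) [AddCommGroup U] [Module Rᵐᵒᵖ U]
    (A : Type w) [AddCommGroup A] [Module R A] : Type (max v w) :=
  (U ⊗[ℤ] A) ⧸ balancedRel R U A

theorem balancedRel_le_comap {R : Type u} [Ring R] (U : Type v) [AddCommGroup U] [Module Rᵐᵒᵖ U]
    {A B : Type w} [AddCommGroup A] [Module R A] [AddCommGroup B] [Module R B] (f : A →ₗ[R] B) :
    balancedRel R U A ≤
      (balancedRel R U B).comap (LinearMap.lTensor U f.toAddMonoidHom.toIntLinearMap) := by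
  refine Submodule.span_le.2 ?_
  rintro _ ⟨u, r, a, rfl⟩
  refine Submodule.subset_span ⟨u, r, f a, ?_⟩
  simp

/-- The homomorphism `U ⊗_R f : U ⊗_R A → U ⊗_R B` induced by `f : A → B`, with
`u ⊗ a ↦ u ⊗ f a`. -/
def rTensorMap {R : Type u} [Ring R] (U : Type v) [AddCommGroup U] [Module Rᵐᵒᵖ U]
    {A B : Type w} [AddCommGroup A] [Module R A] [AddCommGroup B] [Module R B] (f : A →ₗ[R] B) :
    RTensor R U A →ₗ[ℤ] RTensor R U B :=
  Submodule.mapQ (balancedRel R U A) (balancedRel R U B)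
    (LinearMap.lTensor U f.toAddMonoidHom.toIntLinearMap) (balancedRel_le_comap U f)

end Tensor

section Rings

/-- A right `R`-module `U` is flat if `U ⊗_R -` preserves injectivity of maps of left modules. -/
def IsRightFlat (R : Type u) [Ring R] (U : Type v) [AddCommGroup U] [Module Rᵐᵒᵖ U] : Prop :=
  ∀ (A B : Type u) [AddCommGroup A] [AddCommGroup B] [Module R A] [Module R B] (f : A →ₗ[R] B),
    Function.Injective f → Function.Injective (rTensorMap U f)

/-- `R` is a right SF-ring if every simple right `R`-module is flat. -/
def IsRightSFRing (R : Type u) [Ring R] : Prop :=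
  ∀ (U : Type u) [AddCommGroup U] [Module Rᵐᵒᵖ U], IsSimpleModule Rᵐᵒᵖ U → IsRightFlat R U

/-- `R` is von Neumann regular if every `a` satisfies `a = a x a` for some `x`. -/
def IsVonNeumannRegular (R : Type u) [Ring R] : Prop :=
  ∀ a : R, ∃ x : R, a = a * x * a

end Rings

section Modules

/-- A submodule `A` of a left module `B` is coneat if, for every simple right module `U`, the
sequence `0 → U ⊗ A → U ⊗ B → U ⊗ B/A → 0` is exact. -/
def IsConeat {R : Type u} [Ring R] {B : Type v} [AddCommGroup B] [Module R B]
    (A : Submodule R B) : Prop :=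
  ∀ (U : Type u) [AddCommGroup U] [Module Rᵐᵒᵖ U], IsSimpleModule Rᵐᵒᵖ U →
    Function.Injective (rTensorMap U A.subtype) ∧
    Function.Exact (rTensorMap U A.subtype) (rTensorMap U A.mkQ) ∧
    Function.Surjective (rTensorMap U A.mkQ)

/-- `M` is `R`-coneat injective if every map from a coneat left ideal of `R` into `M` extends
to `R`. -/
def IsRConeatInjective (R : Type u) [Ring R] (M : Type v) [AddCommGroup M] [Module R M] : Prop :=
  ∀ C : Submodule R R, IsConeat C → ∀ f : C →ₗ[R] M, ∃ g : R →ₗ[R] M, ∀ c : C, g c = f c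

/-- `M` is self coneat injective if every map from a coneat left ideal of `R` into `M` whose
kernel (a left ideal of `R`) contains the annihilator of some element of `M` extends to `R`. -/
def IsSelfConeatInjective (R : Type u) [Ring R] (M : Type v) [AddCommGroup M] [Module R M] :
    Prop :=
  ∀ C : Submodule R R, IsConeat C → ∀ f : C →ₗ[R] M,
    (∃ m : M, Ideal.torsionOf R M m ≤ (LinearMap.ker f).map C.subtype) →
      ∃ g : R →ₗ[R] M, ∀ c : C, g c = f c

/-- `M` is quasi injective if every map from a submodule of `M` into `M` extends to `M`. -/
def IsQuasiInjective (R : Type u) [Ring R] (M : Type v) [AddCommGroup M] [Module R M] : Prop :=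
  ∀ (A : Submodule R M) (f : A →ₗ[R] M), ∃ g : M →ₗ[R] M, ∀ a : A, g a = f a

end Modules

end ConeatInj

/-! Tensoring is right exact, so coneatness is only injectivity of `U ⊗ A → U ⊗ B` for simple `U`.
Write `U⁺` for the characters `U → ℚ/ℤ`. By Hom-tensor duality (`rTensorMap_injective_iff`), `U ⊗ f`
is injective iff maps into `U⁺` extend along `f`. Hence `U⁺` is `R`-coneat injective for simple `U`,
and `U` is flat once `U⁺` is injective: 3 → 1. When all left ideals are coneat, the two coneat
conditions become the hypotheses of Baer's and Fuchs' criteria (2 → 3, 2 → 5). For 4 → 3, apply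
quasi-injectivity to `M × E` with `E ⊇ R` injective. In the commutative case, regularity supplies
idempotents that reduce every tensor to a pure one; conversely, flatness of `R ⧸ m` gives `a ∈ ma`
for each `a ∈ m`. -/

namespace ConeatInj

/-! ### Tensor products over a noncommutative ring and right exactness -/

section TensorBasics

variable {R : Type u} [Ring R] {U : Type v} [AddCommGroup U] [Module Rᵐᵒᵖ U]
variable {A B : Type w} [AddCommGroup A] [Module R A] [AddCommGroup B] [Module R B]

/-- The class of the pure tensor `x ⊗ a` in `U ⊗_R A`. -/
def rtmul (R : Type u) [Ring R] [Module Rᵐᵒᵖ U] [Module R A] (x : U) (a : A) : RTensor R U A :=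
  (balancedRel R U A).mkQ (x ⊗ₜ[ℤ] a)

theorem rtmul_add (x : U) (a b : A) : rtmul R x (a + b) = rtmul R x a + rtmul R x b := by
  simp only [rtmul, TensorProduct.tmul_add, map_add]

theorem add_rtmul (x y : U) (a : A) : rtmul R (x + y) a = rtmul R x a + rtmul R y a := by
  simp only [rtmul, TensorProduct.add_tmul, map_add]

theorem rtmul_zero (x : U) : rtmul R x (0 : A) = 0 := by
  simp only [rtmul, TensorProduct.tmul_zero, map_zero]

theorem zero_rtmul (a : A) : rtmul R (0 : U) a = 0 := by
  simp only [rtmul, TensorProduct.zero_tmul, map_zero]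

theorem op_smul_rtmul (x : U) (r : R) (a : A) :
    rtmul R (MulOpposite.op r • x) a = rtmul R x (r • a) := by
  rw [← sub_eq_zero, rtmul, rtmul, ← map_sub, Submodule.mkQ_apply, Submodule.Quotient.mk_eq_zero]
  exact Submodule.subset_span ⟨x, r, a, rfl⟩

theorem rTensorMap_rtmul (f : A →ₗ[R] B) (x : U) (a : A) :
    rTensorMap U f (rtmul R x a) = rtmul R x (f a) :=
  rfl

theorem rTensor_induction {p : RTensor R U A → Prop} (z : RTensor R U A)
    (zero : p 0) (tmul : ∀ x a, p (rtmul R x a)) (add : ∀ y z, p y → p z → p (y + z)) : p z := by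
  obtain ⟨t, rfl⟩ := Submodule.mkQ_surjective _ z
  induction t using TensorProduct.induction_on with
  | zero => simpa using zero
  | tmul x a => exact tmul x a
  | add s t hs ht => rw [map_add]; exact add _ _ hs ht

/-- The homomorphism out of `U ⊗_R A` induced by a balanced biadditive map. -/
def rTensorLift {G : Type*} [AddCommGroup G] (β : U →+ A →+ G)
    (hβ : ∀ x (r : R) a, β (MulOpposite.op r • x) a = β x (r • a)) : RTensor R U A →+ G :=
  ((balancedRel R U A).liftQ
    (TensorProduct.liftAddHom β (fun n x a => by simp)).toIntLinearMap
    (Submodule.span_le.2 (by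
      rintro _ ⟨x, r, a, rfl⟩
      simp [hβ]))).toAddMonoidHom

theorem rTensor_addHom_ext {G : Type*} [AddCommGroup G] {f g : RTensor R U A →+ G}
    (h : ∀ x a, f (rtmul R x a) = g (rtmul R x a)) : f = g := by
  ext z
  induction z using rTensor_induction with
  | zero => simp
  | tmul x a => exact h x a
  | add y z hy hz => rw [map_add, map_add, hy, hz]

theorem rTensorMap_surjective {f : A →ₗ[R] B} (hf : Function.Surjective f) :
    Function.Surjective (rTensorMap U f) := by
  intro z
  induction z using rTensor_induction with
  | zero => exact ⟨0, map_zero _⟩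
  | tmul x b =>
    obtain ⟨a, rfl⟩ := hf b
    exact ⟨rtmul R x a, rfl⟩
  | add y z hy hz =>
    obtain ⟨y, rfl⟩ := hy
    obtain ⟨z, rfl⟩ := hz
    exact ⟨y + z, map_add _ _ _⟩

/-- Exactness over `ℤ` passes to the quotients because surjectivity of `g` lifts each balancing
relation of `U ⊗ C` to one of `U ⊗ B`. -/
theorem rTensorMap_exact {C : Type w} [AddCommGroup C] [Module R C] {f : A →ₗ[R] B}
    {g : B →ₗ[R] C} (hfg : Function.Exact f g) (hg : Function.Surjective g) :
    Function.Exact (rTensorMap U f) (rTensorMap U g) := by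
  have hex : Function.Exact (LinearMap.lTensor U f.toAddMonoidHom.toIntLinearMap)
      (LinearMap.lTensor U g.toAddMonoidHom.toIntLinearMap) :=
    lTensor_exact U (f := f.toAddMonoidHom.toIntLinearMap)
      (g := g.toAddMonoidHom.toIntLinearMap) hfg hg
  have hrel : balancedRel R U C ≤
      (balancedRel R U B).map (LinearMap.lTensor U g.toAddMonoidHom.toIntLinearMap) := by
    refine Submodule.span_le.2 ?_
    rintro _ ⟨x, r, c, rfl⟩
    obtain ⟨b, rfl⟩ := hg c
    exact ⟨_, Submodule.subset_span ⟨x, r, b, rfl⟩, by simp⟩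
  intro z
  constructor
  · intro hz
    obtain ⟨t, rfl⟩ := Submodule.mkQ_surjective _ z
    have ht := (Submodule.Quotient.mk_eq_zero _).1 hz
    obtain ⟨s, hs, hst⟩ := hrel ht
    obtain ⟨y, hy⟩ := (hex (t - s)).1 (by rw [map_sub, hst]; exact sub_self _)
    refine ⟨(balancedRel R U A).mkQ y, ?_⟩
    change (balancedRel R U B).mkQ (LinearMap.lTensor U f.toAddMonoidHom.toIntLinearMap y) = _
    rw [hy, map_sub, sub_eq_self]
    exact (Submodule.Quotient.mk_eq_zero _).2 hs
  · rintro ⟨y, rfl⟩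
    induction y using rTensor_induction with
    | zero => simp
    | tmul x a => rw [rTensorMap_rtmul, rTensorMap_rtmul, hfg.apply_apply_eq_zero, rtmul_zero]
    | add y z hy hz => rw [map_add, map_add, hy, hz, add_zero]

theorem isConeat_iff {B : Type v} [AddCommGroup B] [Module R B] {A : Submodule R B} :
    IsConeat A ↔ ∀ (U : Type u) [AddCommGroup U] [Module Rᵐᵒᵖ U], IsSimpleModule Rᵐᵒᵖ U →
      Function.Injective (rTensorMap U A.subtype) :=
  ⟨fun h U _ _ hU => (h U hU).1, fun h U _ _ hU => ⟨h U hU,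
    rTensorMap_exact (fun x => by simp) A.mkQ_surjective, rTensorMap_surjective A.mkQ_surjective⟩⟩

end TensorBasics

/-! ### Character modules and Hom-tensor duality -/

section CharacterDual

variable {R : Type u} [Ring R] {U : Type v} [AddCommGroup U] [Module Rᵐᵒᵖ U]

/-- The character module of a right `R`-module is a left `R`-module, with `(r • c) x = c (x r)`. -/
instance characterModuleLeft : Module R (CharacterModule U) where
  smul r c := AddMonoidHom.comp (M := U) (N := U) c (DistribSMul.toAddMonoidHom U (MulOpposite.op r))
  one_smul c := CharacterModule.ext U fun x => congrArg c (one_smul Rᵐᵒᵖ x)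
  mul_smul r s c := CharacterModule.ext U fun x =>
    congrArg c (mul_smul (MulOpposite.op s) (MulOpposite.op r) x)
  smul_zero _ := rfl
  smul_add _ _ _ := rfl
  add_smul r s c := CharacterModule.ext U fun x =>
    (congrArg c (add_smul (MulOpposite.op r) (MulOpposite.op s) x)).trans (map_add c _ _)
  zero_smul c := CharacterModule.ext U fun x =>
    (congrArg c (zero_smul Rᵐᵒᵖ x)).trans (map_zero c)

variable {A B : Type w} [AddCommGroup A] [Module R A] [AddCommGroup B] [Module R B]

/-- The character of `U ⊗_R A` corresponding to a linear map from `A` to the character module. -/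
def characterUncurry (φ : A →ₗ[R] CharacterModule U) : CharacterModule (RTensor R U A) :=
  rTensorLift (AddMonoidHom.flip (M := A) (N := U) (P := AddCircle (1 : ℚ)) φ.toAddMonoidHom)
    fun x r a => (congrArg (fun c : CharacterModule U => c x) (φ.map_smul r a)).symm

/-- The linear map from `A` to the character module corresponding to a character of `U ⊗_R A`. -/
def characterCurry (χ : CharacterModule (RTensor R U A)) : A →ₗ[R] CharacterModule U where
  toFun a := AddMonoidHom.mk' (fun x => χ (rtmul R x a)) fun x y => by rw [add_rtmul, map_add]
  map_add' a b := CharacterModule.ext U fun x =>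
    (congrArg χ (rtmul_add x a b)).trans (map_add χ _ _)
  map_smul' r a := CharacterModule.ext U fun x => (congrArg χ (op_smul_rtmul x r a)).symm

/-- Maps `A → U⁺` are the characters of `U ⊗ A`. Since `ℚ/ℤ` is injective, characters extend along
an injection; since it cogenerates, a nonzero kernel element would be detected by a character, which
cannot then factor through `U ⊗ f`. -/
theorem rTensorMap_injective_iff (f : A →ₗ[R] B) :
    Function.Injective (rTensorMap U f) ↔
      ∀ φ : A →ₗ[R] CharacterModule U, ∃ ψ : B →ₗ[R] CharacterModule U, ∀ a, ψ (f a) = φ a := by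
  constructor
  · intro hf φ
    obtain ⟨χ, hχ⟩ := CharacterModule.dual_surjective_of_injective _ hf (characterUncurry φ)
    refine ⟨characterCurry χ, fun a => CharacterModule.ext U fun x => ?_⟩
    exact DFunLike.congr_fun hχ (rtmul R x a)
  · intro h
    refine (injective_iff_map_eq_zero _).2 fun z hz => ?_
    by_contra hne
    obtain ⟨χ, hχ⟩ := CharacterModule.exists_character_apply_ne_zero_of_ne_zero hne
    obtain ⟨ψ, hψ⟩ := h (characterCurry χ)
    have key : AddMonoidHom.comp (N := RTensor R U B) (characterUncurry ψ)
        (rTensorMap U f).toAddMonoidHom = χ :=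
      rTensor_addHom_ext fun x a => congrArg (fun c : CharacterModule U => c x) (hψ a)
    apply hχ
    rw [← key]
    change characterUncurry ψ (rTensorMap U f z) = 0
    rw [hz, map_zero]

end CharacterDual

/-! ### Relative injectivity and the criteria of Baer and Fuchs -/

section Injectivity

variable {R : Type u} [Ring R]

theorem isRConeatInjective_characterModule (U : Type u) [AddCommGroup U] [Module Rᵐᵒᵖ U]
    (hU : IsSimpleModule Rᵐᵒᵖ U) : IsRConeatInjective R (CharacterModule U) := fun C hC f =>
  (rTensorMap_injective_iff C.subtype).1 (hC U hU).1 f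

theorem isRightFlat_of_injective_characterModule (U : Type u) [AddCommGroup U] [Module Rᵐᵒᵖ U]
    (h : Module.Injective R (CharacterModule U)) : IsRightFlat R U := fun _ _ _ _ _ _ f hf =>
  (rTensorMap_injective_iff f).2 fun φ => h.out f hf φ

theorem IsRConeatInjective.prod {M N : Type*} [AddCommGroup M] [Module R M] [AddCommGroup N]
    [Module R N] (hM : IsRConeatInjective R M) (hN : IsRConeatInjective R N) :
    IsRConeatInjective R (M × N) := by
  intro C hC f
  obtain ⟨g, hg⟩ := hM C hC (LinearMap.fst R M N ∘ₗ f)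
  obtain ⟨h, hh⟩ := hN C hC (LinearMap.snd R M N ∘ₗ f)
  exact ⟨g.prod h, fun c => Prod.ext (hg c) (hh c)⟩

theorem isRConeatInjective_of_injective {M : Type u} [AddCommGroup M] [Module R M]
    (h : Module.Injective R M) : IsRConeatInjective R M := fun C _ f =>
  h.out C.subtype C.injective_subtype f

theorem isQuasiInjective_of_injective {M : Type u} [AddCommGroup M] [Module R M]
    (h : Module.Injective R M) : IsQuasiInjective R M := fun A f =>
  h.out A.subtype A.injective_subtype f

theorem IsRConeatInjective.isSelfConeatInjective {M : Type*} [AddCommGroup M] [Module R M]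
    (h : IsRConeatInjective R M) : IsSelfConeatInjective R M := fun C hC f _ => h C hC f

theorem exists_injective_embedding (R : Type u) [Ring R] :
    ∃ (E : Type u) (_ : AddCommGroup E) (_ : Module R E) (i : R →ₗ[R] E),
      Module.Injective R E ∧ Function.Injective i := by
  obtain ⟨P⟩ := CategoryTheory.EnoughInjectives.presentation (ModuleCat.of R R)
  have := P.injective
  have := P.mono
  exact ⟨P.J, inferInstance, inferInstance, P.f.hom,
    Module.injective_module_of_injective_object R P.J,
    (ModuleCat.mono_iff_injective P.f).1 inferInstance⟩

/-- A map from a left ideal `L` to `M` becomes a partial endomorphism of `M × E` once `L` is placed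
in the second factor through `i`. Restricting a full extension to the copy of `R` there gives Baer's
criterion. -/
theorem injective_of_isQuasiInjective_prod {M E : Type u} [AddCommGroup M] [Module R M]
    [AddCommGroup E] [Module R E] (i : R →ₗ[R] E) (hi : Function.Injective i)
    (h : IsQuasiInjective R (M × E)) : Module.Injective R M := by
  refine Module.Baer.injective fun L f => ?_
  let j : L →ₗ[R] M × E := LinearMap.inr R M E ∘ₗ i ∘ₗ L.subtype
  have hj : Function.Injective j :=
    LinearMap.inr_injective.comp (hi.comp L.injective_subtype)
  let e := LinearEquiv.ofInjective j hj
  obtain ⟨g, hg⟩ := h (LinearMap.range j) (LinearMap.inl R M E ∘ₗ f ∘ₗ e.symm.toLinearMap)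
  refine ⟨LinearMap.fst R M E ∘ₗ g ∘ₗ LinearMap.inr R M E ∘ₗ i, fun x hx => ?_⟩
  have hx' := hg (e ⟨x, hx⟩)
  simp only [LinearMap.comp_apply, LinearEquiv.coe_coe, LinearEquiv.symm_apply_apply] at hx'
  exact congrArg Prod.fst hx'

/-- Fuchs' criterion for quasi-injectivity. -/
theorem isQuasiInjective_of_extends {M : Type*} [AddCommGroup M] [Module R M]
    (h : ∀ (L : Submodule R R) (f : L →ₗ[R] M),
      (∃ m : M, Ideal.torsionOf R M m ≤ (LinearMap.ker f).map L.subtype) →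
        ∃ g : R →ₗ[R] M, ∀ c : L, g c = f c) : IsQuasiInjective R M := by
  intro A f
  obtain ⟨F, hAF, hF⟩ := zorn_le_nonempty₀ {p : M →ₗ.[R] M | ⟨A, f⟩ ≤ p}
    (fun c hc hchain p hp => ⟨LinearPMap.sSup c hchain.directedOn,
      (hc hp).trans (LinearPMap.le_sSup hchain.directedOn hp),
      fun _ hz => LinearPMap.le_sSup hchain.directedOn hz⟩) ⟨A, f⟩ (le_refl (⟨A, f⟩ : M →ₗ.[R] M))
  have htop : ∀ m, m ∈ F.domain := by
    intro m
    let s : R →ₗ[R] M := LinearMap.toSpanSingleton R M m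
    -- On the left ideal of all `r` with `r • m` in the domain of `F`, `k` sends `r` to `F (r • m)`.
    -- Its kernel contains the annihilator of `m`, so the hypothesis applies.
    let k : F.domain.comap s →ₗ[R] M := F.toFun ∘ₗ s.restrict fun _ hx => hx
    have hzero : ∀ r : R, r • m = 0 → ∃ hr : r • m ∈ F.domain, F ⟨r • m, hr⟩ = 0 := by
      intro r hr
      refine ⟨by rw [hr]; exact F.domain.zero_mem, ?_⟩
      exact (congrArg F (Subtype.ext hr)).trans F.map_zero
    obtain ⟨g, hg⟩ := h _ k ⟨m, fun r hr => by
      obtain ⟨hr', h0⟩ := hzero r hr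
      exact ⟨⟨r, hr'⟩, h0, rfl⟩⟩
    have hg' : ∀ (r : R) (hr : r • m ∈ F.domain), r • g 1 = F ⟨r • m, hr⟩ := by
      intro r hr
      rw [← map_smul, smul_eq_mul, mul_one]
      exact hg ⟨r, hr⟩
    -- The map `r • m ↦ r • g 1` agrees with `F` where both are defined; gluing them and using
    -- maximality puts `m` in the domain of `F`.
    let G : M →ₗ.[R] M := LinearPMap.mkSpanSingleton' m (g 1) fun r hr => by
      obtain ⟨hr', h0⟩ := hzero r hr
      exact (hg' r hr').trans h0
    have hFG : ∀ (x : F.domain) (y : G.domain), (x : M) = y → F x = G y := by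
      rintro ⟨x, hx⟩ ⟨y, hy⟩ (rfl : x = y)
      obtain ⟨r, rfl⟩ := Submodule.mem_span_singleton.1 hy
      rw [LinearPMap.mkSpanSingleton'_apply]
      exact (hg' r hx).symm
    have hle := hF.2 (hAF.trans (F.left_le_sup G hFG)) (F.left_le_sup G hFG)
    exact hle.1 ((F.right_le_sup G hFG).1 (Submodule.mem_span_singleton_self m))
  refine ⟨F.toFun ∘ₗ LinearMap.id.codRestrict F.domain htop, fun a => ?_⟩
  exact (hAF.2 (x := a) (y := ⟨a, htop a⟩) rfl).symm

end Injectivity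

/-! ### Commutative rings and von Neumann regularity -/

section Regular

variable {R : Type u} [Ring R]

/-- Every element of `U ⊗ L` is `x ⊗ e` with `e ∈ L` idempotent. If it dies in `U ⊗ R`, then `xe =
0`, so `x ⊗ e = x ⊗ e·e = xe ⊗ e = 0`. -/
theorem isConeat_of_isVonNeumannRegular (hcomm : ∀ a b : R, a * b = b * a)
    (hR : IsVonNeumannRegular R) (L : Submodule R R) : IsConeat L := by
  refine isConeat_iff.2 fun U _ _ _ => ?_
  have key : ∀ z : RTensor R U L, ∃ (x : U) (e : L), (e : R) * e = e ∧ z = rtmul R x e := by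
    intro z
    induction z using rTensor_induction with
    | zero => exact ⟨0, 0, by simp, (zero_rtmul _).symm⟩
    | tmul x a =>
      obtain ⟨y, hy⟩ := hR a
      -- From `a = aya`, the element `ya` is idempotent and `x ⊗ a = xa ⊗ ya`.
      refine ⟨MulOpposite.op (a : R) • x, y • a, ?_, ?_⟩
      · change y * (a : R) * (y * a) = y * a
        rw [mul_assoc, ← mul_assoc (a : R), ← hy]
      · rw [op_smul_rtmul]
        exact congrArg _ (Subtype.ext (by simpa [mul_assoc] using hy))
    | add s t hs ht =>
      obtain ⟨x, e, he, rfl⟩ := hs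
      obtain ⟨y, f, hf, rfl⟩ := ht
      have hef : (e : R) * f = f * e := hcomm _ _
      -- The join of two commuting idempotents: `eg = e` and `fg = f`, so both tensors can be
      -- rewritten over `g`.
      let g : L := e + f - (e : R) • f
      have heg : (e : R) * g = e := by
        change (e : R) * (e + f - e * f) = e
        rw [mul_sub, mul_add, ← mul_assoc, he, add_sub_cancel_right]
      have hfg : (f : R) * g = f := by
        change (f : R) * (e + f - e * f) = f
        rw [hef, mul_sub, mul_add, ← mul_assoc, hf, add_sub_cancel_left]
      have hgg : (g : R) * g = g := by
        have hg : (g : R) = e + f - e * f := rfl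
        calc (g : R) * g = (e + f - e * f) * g := rfl
          _ = g := by rw [sub_mul, add_mul, mul_assoc, hfg, heg, hg]
      refine ⟨MulOpposite.op (e : R) • x + MulOpposite.op (f : R) • y, g, hgg, ?_⟩
      rw [add_rtmul, op_smul_rtmul, op_smul_rtmul]
      exact congrArg₂ (rtmul R x · + rtmul R y ·) (Subtype.ext heg.symm) (Subtype.ext hfg.symm)
  refine (injective_iff_map_eq_zero _).2 fun z hz => ?_
  obtain ⟨x, e, he, rfl⟩ := key z
  -- The multiplication map `x ⊗ r ↦ xr`.
  let μ : RTensor R U R →+ U := rTensorLift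
    (AddMonoidHom.mk' (fun x => AddMonoidHom.mk' (fun r : R => MulOpposite.op r • x)
      fun r s => by rw [MulOpposite.op_add, add_smul])
      fun x y => by ext r; exact smul_add _ _ _)
    fun x r a => by simp [smul_smul]
  have hx : MulOpposite.op (e : R) • x = 0 := by
    have := congrArg μ hz
    rwa [map_zero] at this
  have hee : e = (e : R) • e := Subtype.ext he.symm
  rw [hee, ← op_smul_rtmul, hx, zero_rtmul]

/-- If tensoring the quotient of `R` by a right ideal `m` with `Ra ⊆ R` is injective, then
`a ∈ m` implies `a ∈ ma`. -/
theorem exists_mul_eq_of_rTensorMap_injective (m : Submodule Rᵐᵒᵖ R) {a : R} (ha : a ∈ m)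
    (h : Function.Injective (rTensorMap (R ⧸ m) (Submodule.span R {a}).subtype)) :
    ∃ y ∈ m, a = y * a := by
  let A : Submodule R R := Submodule.span R {a}
  let a' : A := ⟨a, Submodule.mem_span_singleton_self a⟩
  -- `N` is `mA`, and `τ` below is the map `(R ⧸ m) ⊗ A → A ⧸ mA` sending `1 ⊗ a` to the class of
  -- `a`.
  let N : AddSubgroup A := AddSubgroup.closure {z | ∃ y ∈ m, ∃ b : A, z = y • b}
  let β₀ : R →+ A →+ A ⧸ N := AddMonoidHom.mk'
    (fun r => (QuotientAddGroup.mk' N).comp (DistribSMul.toAddMonoidHom A r))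
    fun r s => by
      ext b
      change QuotientAddGroup.mk' N ((r + s) • b) = _
      rw [add_smul, map_add]
      rfl
  let β : R ⧸ m →+ A →+ A ⧸ N := QuotientAddGroup.lift m.toAddSubgroup β₀ fun y hy => by
    ext b
    exact (QuotientAddGroup.eq_zero_iff _).2 (AddSubgroup.subset_closure ⟨y, hy, b, rfl⟩)
  let τ : RTensor R (R ⧸ m) A →+ A ⧸ N := rTensorLift β fun x r b => by
    obtain ⟨s, rfl⟩ := Submodule.mkQ_surjective m x
    exact congrArg (QuotientAddGroup.mk' N) (mul_smul s r b)
  -- In `(R ⧸ m) ⊗ R` one has `1 ⊗ a = a ⊗ 1 = 0`, because `a ∈ m`; injectivity carries this back to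
  -- `A`.
  have hzero : rtmul R (m.mkQ 1) a' = 0 := by
    apply h
    rw [rTensorMap_rtmul, map_zero]
    change rtmul R (m.mkQ 1) a = 0
    have : a = a • (1 : R) := by simp
    rw [this, ← op_smul_rtmul, ← map_smul]
    have h1 : m.mkQ (MulOpposite.op a • (1 : R)) = 0 := by simpa using ha
    rw [h1, zero_rtmul]
  have hmem : a' ∈ N := by
    have := congrArg τ hzero
    rw [map_zero] at this
    have h1 : τ (rtmul R (m.mkQ 1) a') = QuotientAddGroup.mk' N ((1 : R) • a') := rfl
    rw [h1, one_smul] at this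
    exact (QuotientAddGroup.eq_zero_iff _).1 this
  have hN : ∀ z ∈ N, ∃ y ∈ m, (z : R) = y * a := by
    intro z hz
    induction hz using AddSubgroup.closure_induction with
    | mem z hz =>
      obtain ⟨y, hy, ⟨b, hb⟩, rfl⟩ := hz
      obtain ⟨r, rfl⟩ := Submodule.mem_span_singleton.1 hb
      exact ⟨y * r, m.smul_mem (MulOpposite.op r) hy, by simp [mul_assoc]⟩
    | zero => exact ⟨0, m.zero_mem, by simp⟩
    | add s t _ _ hs ht =>
      obtain ⟨y, hy, hy'⟩ := hs
      obtain ⟨w, hw, hw'⟩ := ht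
      exact ⟨y + w, m.add_mem hy hw, by rw [add_mul, ← hy', ← hw']; rfl⟩
    | neg s _ hs =>
      obtain ⟨y, hy, hy'⟩ := hs
      exact ⟨-y, m.neg_mem hy, by rw [neg_mul, ← hy']; rfl⟩
  exact hN a' hmem

/-- Let `J` be the ideal of all `r` with `ra ∈ aRa`; regularity at `a` means `1 ∈ J`. Otherwise `J`
lies in a maximal `m`, and `a ∈ J ⊆ m` gives `a = ya` with `y ∈ m`. Then `(1 - y)a = 0` puts `1 - y`
in `J ⊆ m`, forcing `1 ∈ m`. -/
theorem IsRightSFRing.isVonNeumannRegular (hcomm : ∀ a b : R, a * b = b * a)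
    (hR : IsRightSFRing R) : IsVonNeumannRegular R := by
  intro a
  let J : Submodule Rᵐᵒᵖ R :=
    { carrier := {r | ∃ x, r * a = a * x * a}
      zero_mem' := ⟨0, by simp⟩
      add_mem' := by
        rintro r s ⟨x, hx⟩ ⟨y, hy⟩
        exact ⟨x + y, by rw [add_mul, hx, hy, mul_add, add_mul]⟩
      smul_mem' := by
        rintro ⟨t⟩ r ⟨x, hx⟩
        refine ⟨x * t, ?_⟩
        change r * t * a = _
        rw [mul_assoc, hcomm t a, ← mul_assoc, hx, mul_assoc, hcomm a t]
        simp only [mul_assoc] }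
  have hJ : J = ⊤ := by
    by_contra hne
    -- Finite generation by `1` is what places a proper right ideal inside a maximal one.
    have : Module.Finite Rᵐᵒᵖ R := ⟨{1}, Submodule.eq_top_iff'.2 fun r =>
      Submodule.mem_span.2 fun p hp => by
        simpa using p.smul_mem (MulOpposite.op r)
          (hp (Finset.mem_coe.2 (Finset.mem_singleton_self 1)))⟩
    obtain ⟨m, hm, hJm⟩ := (eq_top_or_exists_le_coatom J).resolve_left hne
    have haJ : a ∈ J := ⟨1, by simp⟩
    have hsimple : IsSimpleModule Rᵐᵒᵖ (R ⧸ m) := isSimpleModule_iff_isCoatom.2 hm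
    obtain ⟨y, hy, hya⟩ := exists_mul_eq_of_rTensorMap_injective m (hJm haJ)
      (hR _ hsimple _ _ _ (Submodule.injective_subtype _))
    have h1y : 1 - y ∈ J := ⟨0, by rw [sub_mul, one_mul, ← hya]; simp⟩
    have h1 : (1 : R) ∈ m := by simpa using m.add_mem (hJm h1y) hy
    exact hm.1 (Submodule.eq_top_iff'.2 fun r => by
      simpa using m.smul_mem (MulOpposite.op r) h1)
  obtain ⟨x, hx⟩ : (1 : R) ∈ J := hJ ▸ Submodule.mem_top
  exact ⟨x, by rw [← hx, one_mul]⟩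

end Regular

theorem tfae_isRightSFRing (R : Type u) [Ring R] :
    List.TFAE
      [IsRightSFRing R,
       ∀ L : Submodule R R, IsConeat L,
       ∀ (M : Type u) [AddCommGroup M] [Module R M],
          IsRConeatInjective R M → Module.Injective R M,
       ∀ (M : Type u) [AddCommGroup M] [Module R M],
          IsRConeatInjective R M → IsQuasiInjective R M,
       ∀ (M : Type u) [AddCommGroup M] [Module R M],
          IsSelfConeatInjective R M → IsQuasiInjective R M] := by
  tfae_have 1 → 2 := fun h L => isConeat_iff.2 fun U _ _ hU =>
    h U hU _ _ L.subtype L.injective_subtype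
  tfae_have 2 → 3 := fun h M _ _ hM => Module.Baer.injective fun L f => by
    obtain ⟨g, hg⟩ := hM L (h L) f
    exact ⟨g, fun x hx => hg ⟨x, hx⟩⟩
  tfae_have 3 → 1 := fun h U _ _ hU =>
    isRightFlat_of_injective_characterModule U (h _ (isRConeatInjective_characterModule U hU))
  tfae_have 3 → 4 := fun h M _ _ hM => isQuasiInjective_of_injective (h M hM)
  tfae_have 4 → 3 := fun h M _ _ hM => by
    obtain ⟨E, _, _, i, hE, hi⟩ := exists_injective_embedding R
    exact injective_of_isQuasiInjective_prod i hi
      (h (M × E) (hM.prod (isRConeatInjective_of_injective hE)))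
  tfae_have 2 → 5 := fun h M _ _ hM => isQuasiInjective_of_extends fun L f hf => hM L (h L) f hf
  tfae_have 5 → 4 := fun h M _ _ hM => h M hM.isSelfConeatInjective
  tfae_finish

end ConeatInj

theorem mainTheorem3 (R : Type u) [Ring R] :
    List.TFAE
      [ConeatInj.IsRightSFRing R,
       ∀ L : Submodule R R, ConeatInj.IsConeat L,
       ∀ (M : Type u) [AddCommGroup M] [Module R M],
          ConeatInj.IsRConeatInjective R M → Module.Injective R M,
       ∀ (M : Type u) [AddCommGroup M] [Module R M],
          ConeatInj.IsRConeatInjective R M → ConeatInj.IsQuasiInjective R M,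
       ∀ (M : Type u) [AddCommGroup M] [Module R M],
          ConeatInj.IsSelfConeatInjective R M → ConeatInj.IsQuasiInjective R M] ∧
    ((∀ a b : R, a * b = b * a) →
      List.TFAE
        [ConeatInj.IsRightSFRing R,
         ∀ L : Submodule R R, ConeatInj.IsConeat L,
         ∀ (M : Type u) [AddCommGroup M] [Module R M],
            ConeatInj.IsRConeatInjective R M → Module.Injective R M,
         ∀ (M : Type u) [AddCommGroup M] [Module R M],
            ConeatInj.IsRConeatInjective R M → ConeatInj.IsQuasiInjective R M,
         ∀ (M : Type u) [AddCommGroup M] [Module R M],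
            ConeatInj.IsSelfConeatInjective R M → ConeatInj.IsQuasiInjective R M,
         ConeatInj.IsVonNeumannRegular R]) := by
  have h := ConeatInj.tfae_isRightSFRing R
  refine ⟨h, fun hcomm => ?_⟩
  have h12 := h.out 0 1
  have h13 := h.out 0 2
  have h14 := h.out 0 3
  have h15 := h.out 0 4
  tfae_have 1 ↔ 2 := h12
  tfae_have 1 ↔ 3 := h13
  tfae_have 1 ↔ 4 := h14
  tfae_have 1 ↔ 5 := h15
  tfae_have 1 → 6 := fun hR => hR.isVonNeumannRegular hcomm
  tfae_have 6 → 2 := fun hR L => ConeatInj.isConeat_of_isVonNeumannRegular hcomm hR L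
  tfae_finish
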